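/- **Theorem 2.6.** Let $H=-\Delta+V$ on $\mathbb{Z}$, $(\Delta u)(x)=u(x+1)+u(x-1)$, where $V=\{v_x\}_{x\in\mathbb{Z}}$ are i.i.d. random variables on $[0,1]$ with density $g\in L^\infty$. For finite $\Lambda\subset\mathbb{Z}$ let $H_\Lambda=R_\Lambda HR_\Lambda$ be the restriction of $H$ to $\Lambda$, and let $\tilde\mu_j$, $j\in\Lambda$, be its eigenvalues, with normalized eigenvectors $\tilde\phi_j$ (labelled by $\Lambda$ in any way). Let $b\in\mathbb{N}$. There is a constant $C>0$, depending only on $b$ and $g$, such that the following holds. Let $s>1$ and $L,C_0,\gamma_0,q_0>0$. Then there is $\delta_0\in(0,1)$, depending on $b,g,s,L,C_0,\gamma_0,q_0$, such that for all $0<\delta\le\delta_0$ and all balls $\tilde B_k=\{n\in\mathbb{Z}:|n-\beta_k|\le L\}$, $\beta_k\in\mathbb{Z}$, $k=1,\dots,b$, with $$L\le\operatorname{dist}(\tilde B_k,0)\le L^4,\qquad \operatorname{dist}(\tilde B_k,\tilde B_{k'})\ge 6L\quad(k\ne k'),$$ the following holds. Let $\Lambda_2^s=[-2\lfloor|\log\delta|^s\rfloor,\,2\lfloor|\log\delta|^s\rfloor]\cap\mathbb{Z}$,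 $\Lambda=\Lambda_2^s$, and let $\hat S_2^s$ be the event that there are $\tilde\alpha_1,\dots,\tilde\alpha_b\in\Lambda$ and points $c_k\in\tilde B_k$ with $$|\tilde\phi_{\tilde\alpha_k}(\ell)|\le C_0(1+|c_k|)^{q_0}e^{-\gamma_0|\ell-c_k|}\qquad(\ell\in\Lambda,\ k=1,\dots,b),$$ and there are $m\in\mathbb{Z}^b$ with $|m_k|\le1$ for all $k$ and $\sum_{k=1}^b m_k\ne0$, and $j,j'\in\Lambda$ (possibly equal), such that, with $\tilde\omega=(\tilde\mu_{\tilde\alpha_1},\dots,\tilde\mu_{\tilde\alpha_b})$, $$|m\cdot\tilde\omega+\tilde\mu_j-\tilde\mu_{j'}|\le4\delta^{1/8}.$$ Then $$\mathbb{P}(\hat S_2^s)\le|\log\delta|^{Cs}\,\delta^{1/8}.$$ -/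

import Mathlib

open MeasureTheory ProbabilityTheory
open scoped ENNReal

noncomputable section

namespace RandomSchrodinger

/-- The discrete Laplacian on `ℤ` (without diagonal part). -/
def laplacian (u : ℤ → ℝ) (x : ℤ) : ℝ := u (x + 1) + u (x - 1)

/-- The Schrödinger operator `H = -Δ + V` with potential `v`. -/
def hamiltonian (v : ℤ → ℝ) (u : ℤ → ℝ) (x : ℤ) : ℝ := -laplacian u x + v x * u x

/-- The matrix of `H_Λ = R_Λ H R_Λ`; the entry at `(x, y)` is `(H e_y)(x)`. -/
def restrictedHamiltonian (v : ℤ → ℝ) (Λ : Finset ℤ) : Matrix Λ Λ ℝ :=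
  Matrix.of fun x y => hamiltonian v (Pi.single (y : ℤ) 1) (x : ℤ)

/-- `(μ j, φ j)`, `j ∈ Λ`, is a complete list of eigenvalues of `H_Λ` with corresponding
normalized eigenvectors, labelled by the points of `Λ` in an arbitrary way. -/
def IsEigensystem (v : ℤ → ℝ) (Λ : Finset ℤ) (μ : Λ → ℝ)
    (φ : OrthonormalBasis Λ ℝ (EuclideanSpace ℝ Λ)) : Prop :=
  ∀ j : Λ, Module.End.HasEigenvector
    (Matrix.toEuclideanLin (restrictedHamiltonian v Λ)) (μ j) (φ j)

/-- Exponential localization of `f` about the point `c`: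
`|f ℓ| ≤ C₀ (1 + |c|) ^ q₀ * exp (-γ₀ |ℓ - c|)` for all `ℓ ∈ Λ`. -/
def IsLocalizedAt (C₀ γ₀ q₀ : ℝ) {Λ : Finset ℤ} (f : EuclideanSpace ℝ Λ) (c : ℤ) : Prop :=
  ∀ ℓ : Λ, |f ℓ| ≤ C₀ * (1 + |(c : ℝ)|) ^ q₀ * Real.exp (-γ₀ * |((ℓ : ℤ) : ℝ) - (c : ℝ)|)

/-- The balls `{n ∈ ℤ : |n - β k| ≤ L}` have distance between `L` and `L ^ 4` from the origin,
and mutual distance at least `6 L`. -/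
def AdmissibleCenters {b : ℕ} (L : ℝ) (β : Fin b → ℤ) : Prop :=
  (∀ k, L ≤ Metric.infDist 0 (Metric.closedBall (β k) L) ∧
    Metric.infDist 0 (Metric.closedBall (β k) L) ≤ L ^ 4) ∧
  ∀ k k', k ≠ k' → ∀ x ∈ Metric.closedBall (β k) L, ∀ y ∈ Metric.closedBall (β k') L,
    6 * L ≤ dist x y

/-- The box `[-2⌊|log δ| ^ s⌋, 2⌊|log δ| ^ s⌋]` in `ℤ`. -/
def box (δ s : ℝ) : Finset ℤ :=
  Finset.Icc (-2 * ⌊|Real.log δ| ^ s⌋) (2 * ⌊|Real.log δ| ^ s⌋)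

/-- The set of potentials `v` for which, in `Λ = box δ s`, there are `b` eigenpairs of `H_Λ`
localized about points of the balls of radius `L` about `β k`, with eigenvalues `ω k = μ (α k)`,
an integer vector `m` with all `|m k| ≤ 1` and nonzero sum, and `j, j' ∈ Λ`
(`j = j'` is allowed) such that `|m · ω + μ j - μ j'| ≤ 4 δ ^ (1 / 8)`. -/
def resonantPotentials {b : ℕ} (C₀ γ₀ q₀ L : ℝ) (β : Fin b → ℤ) (δ s : ℝ) : Set (ℤ → ℝ) :=
  {v | ∃ (μ : box δ s → ℝ) (φ : OrthonormalBasis (box δ s) ℝ (EuclideanSpace ℝ (box δ s))),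
    IsEigensystem v (box δ s) μ φ ∧
    ∃ α : Fin b → box δ s,
      (∀ k, ∃ c ∈ Metric.closedBall (β k) L, IsLocalizedAt C₀ γ₀ q₀ (φ (α k)) c) ∧
      ∃ m : Fin b → ℤ, ∑ k, m k ≠ 0 ∧ (∀ k, |m k| ≤ 1) ∧
        ∃ j j' : box δ s,
          |(∑ k, (m k : ℝ) * μ (α k)) + μ j - μ j'| ≤ 4 * δ ^ (1 / 8 : ℝ)}

/-- `g` is a bounded probability density on `[0, 1]`. -/
structure IsSiteDensity (g : ℝ → ℝ) : Prop where
  nonneg : ∀ᵐ t, 0 ≤ g t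
  support : ∀ᵐ t, t ∉ Set.Icc (0 : ℝ) 1 → g t = 0
  bounded : MemLp g ∞ volume
  integral_eq_one : ∫ t, g t = 1

/-- The probability measure on `ℝ` with density `g`. -/
def siteLaw (g : ℝ → ℝ) : Measure ℝ := volume.withDensity fun t => ENNReal.ofReal (g t)

end RandomSchrodinger

end

/-! The proof is a Wegner estimate for `F w = ∑ k, c k * E_{i k}(w)`, where the `E_i` are the
ordered eigenvalues of `A + diag w` on the box and `∑ k, c k ≠ 0` is an integer. Lowering the whole
potential by `τ` lowers `F` by `τ * ∑ k, c k`, so `|F| ≤ ε` forces `F` to cross a level when all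
sites move by a multiple of `ε`. Telescoping over the sites (`pi_crossing_le`) leaves crossings
caused by one site.

Coefficients of both signs destroy monotonicity in a single site value `t`, so crossings are counted
algebraically: `F = a` makes `a` an eigenvalue of a Kronecker sum affine in `t`, hence `t` a root of
a polynomial of degree at most `N ^ (b + 2)`, `N` being the size of the box
(`volume_eigenvalueSum_crossing_le`). A union bound over `m` and the eigenvalue indices finishes
(`measure_resonant_le`). -/

namespace RandomSchrodinger

/-! ### Affine pencils and Kronecker sums. -/

open Polynomial in
/-- The values of `t` at which `A + t B` has the eigenvalue `a` are roots of a polynomial of degree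
at most the size of the matrices, which is nonzero unless `a` is an eigenvalue of `A`. -/
lemma exists_polynomial_of_affine_pencil {m : Type*} [Fintype m] [DecidableEq m]
    (A B : Matrix m m ℝ) {a : ℝ} (ha : (A - Matrix.scalar m a).det ≠ 0) :
    ∃ p : ℝ[X], p ≠ 0 ∧ p.natDegree ≤ Fintype.card m ∧
      ∀ t, p.eval t = (A + t • B - Matrix.scalar m a).det := by
  have key : ∀ t, (Matrix.det ((X : ℝ[X]) • B.map C + (A - Matrix.scalar m a).map C)).eval t =
      (A + t • B - Matrix.scalar m a).det := by
    intro t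
    rw [← coe_evalRingHom, RingHom.map_det]
    congr 1
    ext i j
    simp [Matrix.map_apply]
    ring
  refine ⟨_, ?_, natDegree_det_X_add_C_le B (A - Matrix.scalar m a), key⟩
  intro h0
  have := key 0
  rw [h0] at this
  apply ha
  simpa using this.symm

/-- The Kronecker sum `∑ k, c k • (1 ⊗ ⋯ ⊗ A ⊗ ⋯ ⊗ 1)`, with `A` in the `k`-th place. -/
def kroneckerSum {ι n : Type*} [Fintype ι] [DecidableEq ι] [DecidableEq n]
    (c : ι → ℝ) (A : Matrix n n ℝ) : Matrix (ι → n) (ι → n) ℝ :=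
  Matrix.of fun x y => ∑ k, c k *
    (A (x k) (y k) * ∏ l ∈ Finset.univ.erase k, (1 : Matrix n n ℝ) (x l) (y l))

section Kronecker

variable {ι n : Type*} [Fintype ι] [DecidableEq ι] [DecidableEq n]

lemma kroneckerSum_add_smul (c : ι → ℝ) (A B : Matrix n n ℝ) (t : ℝ) :
    kroneckerSum c (A + t • B) = kroneckerSum c A + t • kroneckerSum c B := by
  ext x y
  simp only [kroneckerSum, Matrix.of_apply, Matrix.add_apply, Matrix.smul_apply, smul_eq_mul,
    Finset.mul_sum, ← Finset.sum_add_distrib]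
  refine Finset.sum_congr rfl fun k _ => ?_
  ring

variable [Fintype n]

/-- Each summand acts on a single tensor factor, so a product of eigenvectors is an eigenvector. The
`φ k` may coincide. -/
lemma kroneckerSum_mulVec (c : ι → ℝ) (A : Matrix n n ℝ) (μ : ι → ℝ) (φ : ι → n → ℝ)
    (h : ∀ k, A.mulVec (φ k) = μ k • φ k) :
    (kroneckerSum c A).mulVec (fun y => ∏ l, φ l (y l)) =
      (∑ k, c k * μ k) • fun y => ∏ l, φ l (y l) := by
  have single : ∀ (k : ι) (x : ι → n),
      ∑ y : ι → n, (A (x k) (y k) * ∏ l ∈ Finset.univ.erase k, (1 : Matrix n n ℝ) (x l) (y l)) *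
        ∏ l, φ l (y l) = μ k * ∏ l, φ l (x l) := by
    intro k x
    -- As a product over `l` of functions of `y l` alone, the summand can be summed factor by
    -- factor.
    have e1 : ∀ y : ι → n,
        (A (x k) (y k) * ∏ l ∈ Finset.univ.erase k, (1 : Matrix n n ℝ) (x l) (y l)) *
        ∏ l, φ l (y l) = ∏ l, (if l = k then A else 1) (x l) (y l) * φ l (y l) := by
      intro y
      rw [Finset.prod_mul_distrib]
      congr 1
      rw [← Finset.mul_prod_erase _ _ (Finset.mem_univ k)]
      congr 1
      · simp
      · refine Finset.prod_congr rfl fun l hl => ?_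
        rw [if_neg (Finset.ne_of_mem_erase hl)]
    simp_rw [e1]
    have e2 := Finset.prod_univ_sum (fun _ : ι => (Finset.univ : Finset n))
      (fun l y => (if l = k then A else 1) (x l) y * φ l y)
    rw [Fintype.piFinset_univ] at e2
    rw [← e2, ← Finset.mul_prod_erase _ _ (Finset.mem_univ k),
      ← Finset.mul_prod_erase Finset.univ (fun l => φ l (x l)) (Finset.mem_univ k), ← mul_assoc]
    congr 1
    · have := congrFun (h k) (x k)
      simpa [Matrix.mulVec, dotProduct] using this
    · refine Finset.prod_congr rfl fun l hl => ?_
      rw [if_neg (Finset.ne_of_mem_erase hl)]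
      simp [Matrix.one_apply]
  ext x
  simp only [Matrix.mulVec, dotProduct, kroneckerSum, Matrix.of_apply, Pi.smul_apply, smul_eq_mul,
    Finset.sum_mul]
  rw [Finset.sum_comm]
  refine Finset.sum_congr rfl fun k _ => ?_
  rw [mul_assoc, ← single k x, Finset.mul_sum]
  exact Finset.sum_congr rfl fun y _ => by ring

lemma det_kroneckerSum_sub_eq_zero (c : ι → ℝ) (A : Matrix n n ℝ) (μ : ι → ℝ) (φ : ι → n → ℝ)
    (h : ∀ k, A.mulVec (φ k) = μ k • φ k) (hφ : ∀ k, φ k ≠ 0) :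
    (kroneckerSum c A - Matrix.scalar (ι → n) (∑ k, c k * μ k)).det = 0 := by
  refine Matrix.exists_mulVec_eq_zero_iff.mp ⟨fun y => ∏ l, φ l (y l), ?_, ?_⟩
  · choose y hy using fun k => Function.ne_iff.mp (hφ k)
    exact Function.ne_iff.mpr ⟨y, Finset.prod_ne_zero_iff.mpr fun l _ => hy l⟩
  · rw [Matrix.sub_mulVec, kroneckerSum_mulVec c A μ φ h]
    generalize ∑ k, c k * μ k = s
    ext x
    simp [Matrix.scalar_apply]

end Kronecker

/-! ### Ordered eigenvalues as functions of the potential. -/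

/-- **Weyl's inequality** for the ordered eigenvalues of two symmetric operators. -/
lemma eigenvalues_le_add {E : Type*} [NormedAddCommGroup E] [InnerProductSpace ℝ E]
    [FiniteDimensional ℝ E] {N : ℕ} (hN : Module.finrank ℝ E = N) {S T : E →ₗ[ℝ] E}
    (hS : S.IsSymmetric) (hT : T.IsSymmetric) {r : ℝ}
    (h : ∀ x, inner ℝ (S x) x ≤ inner ℝ (T x) x + r * ‖x‖ ^ 2) (i : Fin N) :
    hS.eigenvalues hN i ≤ hT.eigenvalues hN i + r := by
  have quad : ∀ {R : E →ₗ[ℝ] E} (hR : R.IsSymmetric) (x : E), inner ℝ (R x) x =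
      ∑ j, hR.eigenvalues hN j * (hR.eigenvectorBasis hN).repr x j ^ 2 := by
    intro R hR x
    rw [← (hR.eigenvectorBasis hN).repr.inner_map_map, PiLp.inner_apply]
    refine Finset.sum_congr rfl fun j _ => ?_
    rw [hR.eigenvectorBasis_apply_self_apply hN x j]
    simp
    ring
  have nrm : ∀ {R : E →ₗ[ℝ] E} (hR : R.IsSymmetric) (x : E), ‖x‖ ^ 2 =
      ∑ j, (hR.eigenvectorBasis hN).repr x j ^ 2 := by
    intro R hR x
    rw [← (hR.eigenvectorBasis hN).repr.norm_map, EuclideanSpace.norm_sq_eq]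
    simp
  -- Only `N - 1` linear conditions, so some `x ≠ 0` lies both in the span of the eigenvectors of
  -- `T` with index `≥ i` and in that of `S` with index `≤ i`; eigenvalues are in decreasing order.
  let f : E →ₗ[ℝ] ({j : Fin N // j ≠ i} → ℝ) := LinearMap.pi fun j =>
    if (j : Fin N) < i then
      (EuclideanSpace.proj (j : Fin N)).toLinearMap ∘ₗ
        (hT.eigenvectorBasis hN).repr.toLinearEquiv.toLinearMap
    else
      (EuclideanSpace.proj (j : Fin N)).toLinearMap ∘ₗ
        (hS.eigenvectorBasis hN).repr.toLinearEquiv.toLinearMap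
  have hker : LinearMap.ker f ≠ ⊥ := by
    apply LinearMap.ker_ne_bot_of_finrank_lt
    rw [hN, Module.finrank_fintype_fun_eq_card, Fintype.card_subtype_compl]
    have := i.pos
    simp
    omega
  obtain ⟨x, hx, hx0⟩ := (Submodule.ne_bot_iff _).mp hker
  have hxT : ∀ j < i, (hT.eigenvectorBasis hN).repr x j = 0 := by
    intro j hj
    have := congrFun (LinearMap.mem_ker.mp hx) ⟨j, hj.ne⟩
    simpa [f, hj] using this
  have hxS : ∀ j, i < j → (hS.eigenvectorBasis hN).repr x j = 0 := by
    intro j hj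
    have := congrFun (LinearMap.mem_ker.mp hx) ⟨j, hj.ne'⟩
    simpa [f, hj.not_gt] using this
  have h1 : inner ℝ (T x) x ≤ hT.eigenvalues hN i * ‖x‖ ^ 2 := by
    rw [quad hT, nrm hT, Finset.mul_sum]
    refine Finset.sum_le_sum fun j _ => ?_
    rcases lt_or_ge j i with hj | hj
    · simp [hxT j hj]
    · exact mul_le_mul_of_nonneg_right (hT.eigenvalues_antitone hN hj) (sq_nonneg _)
  have h2 : hS.eigenvalues hN i * ‖x‖ ^ 2 ≤ inner ℝ (S x) x := by
    rw [quad hS, nrm hS, Finset.mul_sum]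
    refine Finset.sum_le_sum fun j _ => ?_
    rcases le_or_gt j i with hj | hj
    · exact mul_le_mul_of_nonneg_right (hS.eigenvalues_antitone hN hj) (sq_nonneg _)
    · simp [hxS j hj]
  have hpos : 0 < ‖x‖ ^ 2 := by positivity
  refine le_of_mul_le_mul_right ?_ hpos
  linarith [h x]

section Diagonal

variable {n : Type*} [Fintype n] [DecidableEq n] {A : Matrix n n ℝ} (hA : A.IsHermitian)

/-- The ordered eigenvalues of `A + diag w`, indexed by the sites. -/
noncomputable def siteEigenvalues (w : n → ℝ) : n → ℝ :=
  (hA.add (Matrix.isHermitian_diagonal w)).eigenvalues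

lemma siteEigenvalues_le_add {w w' : n → ℝ} {r : ℝ} (h : ∀ x, w x ≤ w' x + r) (i : n) :
    siteEigenvalues hA w i ≤ siteEigenvalues hA w' i + r := by
  unfold siteEigenvalues Matrix.IsHermitian.eigenvalues Matrix.IsHermitian.eigenvalues₀
  refine eigenvalues_le_add _ _ _ (fun x => ?_) _
  simp only [map_add, LinearMap.add_apply, inner_add_left, add_assoc]
  refine add_le_add le_rfl ?_
  rw [EuclideanSpace.norm_sq_eq, PiLp.inner_apply, PiLp.inner_apply, Finset.mul_sum,
    ← Finset.sum_add_distrib]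
  refine Finset.sum_le_sum fun j _ => ?_
  simp [Matrix.mulVec_diagonal]
  nlinarith [h j, sq_nonneg (x j)]

lemma siteEigenvalues_add_const (w : n → ℝ) (r : ℝ) (i : n) :
    siteEigenvalues hA (fun x => w x + r) i = siteEigenvalues hA w i + r := by
  apply le_antisymm
  · exact siteEigenvalues_le_add hA (fun x => le_rfl) i
  · have := siteEigenvalues_le_add hA (w := w) (w' := fun x => w x + r) (r := -r)
      (fun x => by simp) i
    linarith

lemma continuous_siteEigenvalues (i : n) : Continuous fun w => siteEigenvalues hA w i := by
  have : LipschitzWith 1 fun w => siteEigenvalues hA w i := by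
    refine LipschitzWith.of_le_add fun w w' => ?_
    refine siteEigenvalues_le_add hA (fun x => ?_) i
    have := (Real.dist_eq _ _ ▸ dist_le_pi_dist w w' x : |w x - w' x| ≤ _)
    linarith [le_abs_self (w x - w' x)]
  exact this.continuous

lemma exists_siteEigenvector (w : n → ℝ) (i : n) : ∃ φ : n → ℝ, φ ≠ 0 ∧
    (A + Matrix.diagonal w).mulVec φ = siteEigenvalues hA w i • φ := by
  refine ⟨_, ?_, (hA.add (Matrix.isHermitian_diagonal w)).mulVec_eigenvectorBasis i⟩
  intro h
  have := (hA.add (Matrix.isHermitian_diagonal w)).eigenvectorBasis.orthonormal.ne_zero i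
  exact this (by ext x; exact congrFun h x)

lemma exists_siteEigenvalues_eq (w : n → ℝ) {μ : ℝ} (hμ : Module.End.HasEigenvalue
    (Matrix.toEuclideanLin (A + Matrix.diagonal w)) μ) : ∃ i, siteEigenvalues hA w i = μ := by
  have h := hA.add (Matrix.isHermitian_diagonal w)
  have := hμ.mem_spectrum
  rw [Matrix.spectrum_toLpLin, h.spectrum_real_eq_range_eigenvalues] at this
  exact this

end Diagonal

/-! ### Level crossings in one site value. -/

section Crossing

/-- A continuous function whose `a`-level set lies in the zero set of a polynomial of degree at most
`D` crosses the level `a` upwards within time `τ` only on a set of measure at most `D τ`. -/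
lemma volume_crossing_le_of_polynomial {G : ℝ → ℝ} (hG : Continuous G) {a τ : ℝ} (hτ : 0 ≤ τ)
    {p : Polynomial ℝ} (hp : p ≠ 0) {D : ℕ} (hD : p.natDegree ≤ D)
    (hroot : ∀ t, G t = a → p.eval t = 0) :
    volume {t | G (t - τ) < a ∧ a ≤ G t} ≤ D * ENNReal.ofReal τ := by
  have hsub : {t | G (t - τ) < a ∧ a ≤ G t} ⊆ ⋃ r ∈ p.roots.toFinset, Set.Icc r (r + τ) := by
    rintro t ⟨h1, h2⟩
    obtain ⟨r, hr, hGr⟩ := intermediate_value_Icc (by linarith : t - τ ≤ t) hG.continuousOn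
      ⟨h1.le, h2⟩
    simp only [Set.mem_iUnion]
    refine ⟨r, ?_, by linarith [hr.2], by linarith [hr.1]⟩
    simpa [hp] using hroot r hGr
  calc volume {t | G (t - τ) < a ∧ a ≤ G t}
      ≤ ∑ r ∈ p.roots.toFinset, volume (Set.Icc r (r + τ)) :=
        (measure_mono hsub).trans (measure_biUnion_finset_le _ _)
    _ = p.roots.toFinset.card * ENNReal.ofReal τ := by simp [Real.volume_Icc]
    _ ≤ D * ENNReal.ofReal τ := by
        gcongr
        exact p.roots.toFinset_card_le.trans (p.card_roots'.trans hD)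

/-- A bound on upward crossings for all but finitely many levels holds for every level. -/
lemma volume_crossing_le_of_finite {G : ℝ → ℝ} {τ : ℝ} {K : ℝ≥0∞} {bad : Set ℝ}
    (hbad : bad.Finite)
    (h : ∀ a ∉ bad, volume {t | G (t - τ) < a ∧ a ≤ G t} ≤ K) (a : ℝ) :
    volume {t | G (t - τ) < a ∧ a ≤ G t} ≤ K := by
  -- A bad level `a` is approached from below by good levels `e k`; as `G (t - τ) < a` is strict,
  -- the events increase to the one for `a`.
  obtain ⟨a', ha', hIoo⟩ : ∃ a' < a, ∀ e ∈ Set.Ioo a' a, e ∉ bad := by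
    have : (bad \ {a})ᶜ ∈ nhds a :=
      (hbad.subset Set.sdiff_subset).isClosed.isOpen_compl.mem_nhds (by simp)
    obtain ⟨l, u, hlu, hsub⟩ := mem_nhds_iff_exists_Ioo_subset.mp this
    exact ⟨l, hlu.1, fun e he hb => hsub ⟨he.1, he.2.trans hlu.2⟩ ⟨hb, by simp [he.2.ne]⟩⟩
  obtain ⟨e, hmono, hmem, hlim⟩ := exists_seq_strictMono_tendsto' ha'
  have hU : {t | G (t - τ) < a ∧ a ≤ G t} = ⋃ k, {t | G (t - τ) < e k ∧ a ≤ G t} := by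
    ext t
    simp only [Set.mem_ofPred_eq, Set.mem_iUnion, exists_and_right]
    refine and_congr_left fun _ => ⟨fun ht => ?_, fun ⟨k, hk⟩ => hk.trans (hmem k).2⟩
    exact (hlim.eventually_const_lt ht).exists
  have hmono' : Monotone fun k => {t | G (t - τ) < e k ∧ a ≤ G t} :=
    fun k l hkl t ht => ⟨ht.1.trans_le (hmono.monotone hkl), ht.2⟩
  rw [hU, hmono'.measure_iUnion]
  refine iSup_le fun k => (measure_mono ?_).trans (h (e k) (hIoo _ (hmem k)))
  exact fun t ht => ⟨ht.1, (hmem k).2.le.trans ht.2⟩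

end Crossing

section EigenvalueSum

variable {ι n : Type*} [Fintype ι] [Fintype n] [DecidableEq n]
  {A : Matrix n n ℝ} (hA : A.IsHermitian)

/-- The linear combination with coefficients `c` of the eigenvalues of `A + diag w` numbered
by `i`. -/
noncomputable def eigenvalueSum (c : ι → ℝ) (i : ι → n) (w : n → ℝ) : ℝ :=
  ∑ k, c k * siteEigenvalues hA w (i k)

lemma continuous_eigenvalueSum (c : ι → ℝ) (i : ι → n) : Continuous (eigenvalueSum hA c i) :=
  continuous_finsetSum _ fun k _ => (continuous_siteEigenvalues hA (i k)).const_mul _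

lemma eigenvalueSum_add_const (c : ι → ℝ) (i : ι → n) (w : n → ℝ) (r : ℝ) :
    eigenvalueSum hA c i (fun x => w x + r) = eigenvalueSum hA c i w + r * ∑ k, c k := by
  simp only [eigenvalueSum, siteEigenvalues_add_const, mul_add, Finset.sum_add_distrib,
    ← Finset.sum_mul, mul_comm r]

variable [DecidableEq ι]

lemma det_kroneckerSum_sub_eigenvalueSum (c : ι → ℝ) (i : ι → n) (w : n → ℝ) :
    (kroneckerSum c (A + Matrix.diagonal w) -
      Matrix.scalar (ι → n) (eigenvalueSum hA c i w)).det = 0 := by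
  choose φ hφ0 hφ using fun k => exists_siteEigenvector hA w (i k)
  exact det_kroneckerSum_sub_eq_zero c _ (fun k => siteEigenvalues hA w (i k)) φ hφ hφ0

lemma volume_eigenvalueSum_crossing_le (c : ι → ℝ) (i : ι → n) (w : n → ℝ) (x : n) {τ : ℝ}
    (hτ : 0 ≤ τ) (a : ℝ) :
    volume {t | eigenvalueSum hA c i (Function.update w x (t - τ)) < a ∧
      a ≤ eigenvalueSum hA c i (Function.update w x t)} ≤
      (Fintype.card (ι → n) : ℕ) * ENNReal.ofReal τ := by
  set A₀ := A + Matrix.diagonal (Function.update w x 0) with hA₀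
  have hpencil : ∀ t, A + Matrix.diagonal (Function.update w x t) =
      A₀ + t • Matrix.diagonal (Pi.single x 1) := by
    intro t
    rw [hA₀, add_assoc]
    congr 1
    ext y z
    rcases eq_or_ne y z with rfl | hyz
    · rcases eq_or_ne y x with rfl | hyx
      · simp
      · simp [hyx]
    · simp [hyz]
  -- The bad levels are the eigenvalues of the Kronecker sum at `t = 0`.
  have hbad : {e : ℝ | (kroneckerSum c A₀ - Matrix.scalar (ι → n) e).det = 0}.Finite := by
    refine ((kroneckerSum c A₀).charpoly.roots.toFinset.finite_toSet).subset fun e he => ?_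
    have he : (kroneckerSum c A₀ - Matrix.scalar (ι → n) e).det = 0 := he
    simp only [Finset.mem_coe, Multiset.mem_toFinset, Polynomial.mem_roots',
      Polynomial.IsRoot.def, Matrix.eval_charpoly]
    refine ⟨(Matrix.charpoly_monic _).ne_zero, ?_⟩
    rw [← neg_sub, Matrix.det_neg, he, mul_zero]
  refine volume_crossing_le_of_finite
    (G := fun t => eigenvalueSum hA c i (Function.update w x t)) hbad (fun e he => ?_) a
  obtain ⟨p, hp0, hdeg, hp⟩ := exists_polynomial_of_affine_pencil (kroneckerSum c A₀)
    (kroneckerSum c (Matrix.diagonal (Pi.single x 1))) he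
  refine volume_crossing_le_of_polynomial ((continuous_eigenvalueSum hA c i).comp
    (continuous_const.update x continuous_id)) hτ hp0 hdeg fun t ht => ?_
  rw [hp, ← kroneckerSum_add_smul, ← hpencil, ← ht]
  exact det_kroneckerSum_sub_eigenvalueSum hA c i _

end EigenvalueSum

/-! ### From one site to all sites. -/

section Telescoping

variable {n : Type*} [Fintype n] [DecidableEq n]

/-- A set whose sections in the direction of one coordinate all have measure at most `K` has product
measure at most `K`. -/
lemma pi_le_of_forall_section_le {ν : Measure ℝ} [IsProbabilityMeasure ν] {s : Set (n → ℝ)}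
    (hs : MeasurableSet s) (x : n) {K : ℝ≥0∞}
    (h : ∀ w : n → ℝ, ν {t | Function.update w x t ∈ s} ≤ K) :
    Measure.pi (fun _ : n => ν) s ≤ K := by
  have hmeas : Measurable (s.indicator (1 : (n → ℝ) → ℝ≥0∞)) := measurable_one.indicator hs
  have := lintegral_le_of_lmarginal_le (μ := fun _ : n => ν) {x} hmeas
    (measurable_const (a := K)) (fun w => ?_)
  · simpa [lintegral_indicator_one hs] using this
  · rw [lmarginal_singleton, lmarginal_singleton]
    have e : (fun t => s.indicator (1 : (n → ℝ) → ℝ≥0∞) (Function.update w x t)) =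
        {t | Function.update w x t ∈ s}.indicator 1 := rfl
    simp only [e, lintegral_const, measure_univ, mul_one]
    exact (lintegral_indicator_one (hs.preimage (measurable_update w))).trans_le (h w)

/-- Passing from `w` to `w - τ` on the set `S` one site at a time, `F` crosses the level `a` with
probability at most `#S` times the bound for a single site. -/
lemma pi_crossing_le {ν : Measure ℝ} [IsProbabilityMeasure ν] {F : (n → ℝ) → ℝ}
    (hF : Measurable F) {a τ : ℝ} {K : ℝ≥0∞}
    (h : ∀ (w : n → ℝ) (x : n),
      ν {t | F (Function.update w x (t - τ)) < a ∧ a ≤ F (Function.update w x t)} ≤ K)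
    (S : Finset n) :
    Measure.pi (fun _ : n => ν) {w | F (S.piecewise (fun y => w y - τ) w) < a ∧ a ≤ F w} ≤
      S.card * K := by
  have hpw : ∀ S : Finset n,
      Measurable fun w : n → ℝ => F (S.piecewise (fun y => w y - τ) w) := by
    intro S
    refine hF.comp (measurable_pi_lambda _ fun y => ?_)
    by_cases hy : y ∈ S
    · simpa [hy] using (measurable_pi_apply (X := fun _ : n => ℝ) y).sub_const τ
    · simpa [hy] using measurable_pi_apply y
  induction S using Finset.induction_on with
  | empty =>
    have : {w : n → ℝ | F w < a ∧ a ≤ F w} = ∅ := by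
      ext w
      simp
    simp [this]
  | insert x S hx ih =>
    let E := {w : n → ℝ | F ((insert x S).piecewise (fun y => w y - τ) w) < a ∧
      a ≤ F (S.piecewise (fun y => w y - τ) w)}
    have hE : MeasurableSet E :=
      (measurableSet_lt (hpw _) measurable_const).inter (measurableSet_le measurable_const (hpw _))
    have hsub : {w | F ((insert x S).piecewise (fun y => w y - τ) w) < a ∧ a ≤ F w} ⊆
        E ∪ {w | F (S.piecewise (fun y => w y - τ) w) < a ∧ a ≤ F w} := by
      rintro w ⟨h1, h2⟩
      rcases le_or_gt a (F (S.piecewise (fun y => w y - τ) w)) with h3 | h3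
      · exact Or.inl ⟨h1, h3⟩
      · exact Or.inr ⟨h3, h2⟩
    have hEK : Measure.pi (fun _ : n => ν) E ≤ K := by
      refine pi_le_of_forall_section_le hE x fun w => ?_
      -- The sites of `S` are already shifted, which is harmless because `h` holds at every base
      -- point; `x ∉ S` leaves the coordinate `x` free.
      refine le_of_eq_of_le (congrArg ν ?_) (h (S.piecewise (fun y => w y - τ) w) x)
      ext t
      have e1 : (insert x S).piecewise (fun y => Function.update w x t y - τ)
          (Function.update w x t) =
          Function.update (S.piecewise (fun y => w y - τ) w) x (t - τ) := by
        ext y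
        rcases eq_or_ne y x with rfl | hyx
        · simp
        · by_cases hy : y ∈ S <;> simp [hy, hyx]
      have e2 : S.piecewise (fun y => Function.update w x t y - τ) (Function.update w x t) =
          Function.update (S.piecewise (fun y => w y - τ) w) x t := by
        ext y
        rcases eq_or_ne y x with rfl | hyx
        · simp [hx]
        · by_cases hy : y ∈ S <;> simp [hy, hyx]
      simp only [E, Set.mem_ofPred_eq, e1, e2]
    rw [Finset.card_insert_of_notMem hx]
    push_cast
    rw [add_mul, one_mul, add_comm]
    exact (measure_mono hsub).trans ((measure_union_le _ _).trans (add_le_add hEK ih))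

end Telescoping

section Wegner

variable {ι n : Type*} [Fintype ι] [DecidableEq ι] [Fintype n] [DecidableEq n]
  {A : Matrix n n ℝ} (hA : A.IsHermitian)

/-- **Wegner estimate** for a combination of eigenvalues with nonzero total weight. -/
lemma pi_abs_eigenvalueSum_le {ν : Measure ℝ} [IsProbabilityMeasure ν] {ρ : ℝ≥0∞}
    (hν : ν ≤ ρ • volume) (c : ι → ℝ) (hc : 1 ≤ |∑ k, c k|) (i : ι → n) {ε : ℝ} (hε : 0 < ε) :
    Measure.pi (fun _ : n => ν) {w | |eigenvalueSum hA c i w| ≤ ε} ≤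
      Fintype.card n * (ρ * ((Fintype.card (ι → n) : ℕ) * ENNReal.ofReal (3 * ε))) := by
  wlog hpos : 1 ≤ ∑ k, c k generalizing c with H
  · have hneg : 1 ≤ ∑ k, (-c) k := by
      simp only [Pi.neg_apply, Finset.sum_neg_distrib]
      rcases le_abs'.mp hc with h | h
      · linarith
      · exact absurd h hpos
    have := H (-c) (hneg.trans (le_abs_self _)) hneg
    refine le_of_eq_of_le ?_ this
    simp [eigenvalueSum]
  have hsec : ∀ (w : n → ℝ) (x : n),
      ν {t | eigenvalueSum hA c i (Function.update w x (t - 3 * ε)) < -ε ∧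
        -ε ≤ eigenvalueSum hA c i (Function.update w x t)} ≤
      ρ * ((Fintype.card (ι → n) : ℕ) * ENNReal.ofReal (3 * ε)) := by
    intro w x
    refine (hν _).trans ?_
    rw [Measure.smul_apply, smul_eq_mul]
    gcongr
    exact volume_eigenvalueSum_crossing_le hA c i w x (by positivity) (-ε)
  have := pi_crossing_le (continuous_eigenvalueSum hA c i).measurable hsec Finset.univ
  rw [Finset.card_univ] at this
  refine (measure_mono fun w hw => ?_).trans this
  have hw : |eigenvalueSum hA c i w| ≤ ε := hw
  obtain ⟨h1, h2⟩ := abs_le.mp hw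
  refine ⟨?_, h1⟩
  -- With total weight at least `1`, the shift by `3 * ε` takes a value at most `ε` to at most `-2 *
  -- ε < -ε`.
  have e := eigenvalueSum_add_const hA c i w (-(3 * ε))
  simp only [Finset.piecewise_univ]
  simp only [← sub_eq_add_neg] at e
  rw [e]
  nlinarith

end Wegner

/-! ### Application to the random Schrödinger operator. -/

lemma siteLaw_le {g : ℝ → ℝ} : siteLaw g ≤ eLpNorm g ∞ volume • volume := by
  rw [siteLaw, ← withDensity_const]
  refine withDensity_mono ?_
  filter_upwards [ae_le_eLpNormEssSup (f := g) (μ := volume)] with t ht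
  rw [eLpNorm_exponent_top]
  refine le_trans ?_ ht
  rw [← ofReal_norm]
  exact ENNReal.ofReal_le_ofReal (Real.le_norm_self _)

lemma restrictedHamiltonian_eq_add_diagonal (v : ℤ → ℝ) (Λ : Finset ℤ) :
    restrictedHamiltonian v Λ =
      restrictedHamiltonian 0 Λ + Matrix.diagonal fun x : Λ => v x := by
  ext x y
  rcases eq_or_ne x y with rfl | hxy
  · simp [restrictedHamiltonian, hamiltonian]
  · simp [restrictedHamiltonian, hamiltonian, hxy, Pi.single_apply]

lemma restrictedHamiltonian_isHermitian (v : ℤ → ℝ) (Λ : Finset ℤ) :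
    (restrictedHamiltonian v Λ).IsHermitian := by
  ext x y
  rcases eq_or_ne x y with rfl | hxy
  · simp
  · have h : (x : ℤ) ≠ y := fun h => hxy (Subtype.ext h)
    simp only [restrictedHamiltonian, hamiltonian, laplacian, Matrix.conjTranspose_apply,
      Matrix.of_apply, Pi.single_apply, star_trivial, h, h.symm, if_false, mul_zero, add_zero]
    have e1 : (y : ℤ) + 1 = x ↔ (x : ℤ) - 1 = y := by omega
    have e2 : (y : ℤ) - 1 = x ↔ (x : ℤ) + 1 = y := by omega
    simp only [e1, e2, add_comm]

lemma card_box_le {δ s : ℝ} (h : 1 ≤ |Real.log δ| ^ s) :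
    (Fintype.card (box δ s) : ℝ) ≤ 5 * |Real.log δ| ^ s := by
  have hf : 0 ≤ ⌊|Real.log δ| ^ s⌋ := Int.floor_nonneg.mpr (by linarith)
  have hc : (Fintype.card (box δ s) : ℤ) = 4 * ⌊|Real.log δ| ^ s⌋ + 1 := by
    rw [Fintype.card_coe, box, Int.card_Icc]
    omega
  have hc' : (Fintype.card (box δ s) : ℝ) = 4 * (⌊|Real.log δ| ^ s⌋ : ℝ) + 1 := by
    exact_mod_cast hc
  linarith [Int.floor_le (|Real.log δ| ^ s)]

/-- The coefficients of `m · ω + μ j - μ j'`, for `m k ∈ {-1, 0, 1}` encoded in `Fin 3`. -/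
def resonanceCoeff {b : ℕ} (m : Fin b → Fin 3) : Fin b ⊕ Fin 2 → ℝ :=
  Sum.elim (fun k => ((m k : ℕ) : ℝ) - 1) ![1, -1]

/-- Resonances are small values of eigenvalue sums with nonzero integer weight. -/
lemma exists_abs_eigenvalueSum_le {b : ℕ} {C₀ γ₀ q₀ L δ s : ℝ} {β : Fin b → ℤ} {v : ℤ → ℝ}
    (hv : v ∈ resonantPotentials C₀ γ₀ q₀ L β δ s) :
    ∃ m : Fin b → Fin 3, 1 ≤ |∑ k, resonanceCoeff m k| ∧ ∃ i : Fin b ⊕ Fin 2 → box δ s,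
      |eigenvalueSum (restrictedHamiltonian_isHermitian 0 (box δ s)) (resonanceCoeff m) i
        fun x => v x| ≤ 4 * δ ^ (1 / 8 : ℝ) := by
  obtain ⟨μ, φ, heig, α, -, m, hm0, hm1, j, j', hres⟩ := hv
  have hidx : ∀ l, ∃ i, siteEigenvalues (restrictedHamiltonian_isHermitian 0 (box δ s))
      (fun x : box δ s => v x) i = μ l := by
    intro l
    apply exists_siteEigenvalues_eq
    rw [← restrictedHamiltonian_eq_add_diagonal]
    exact Module.End.hasEigenvalue_of_hasEigenvector (heig l)
  choose σ hσ using hidx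
  have hm : ∀ k, ∃ e : Fin 3, ((e : ℕ) : ℝ) - 1 = m k := by
    intro k
    obtain ⟨h1, h2⟩ := abs_le.mp (hm1 k)
    refine ⟨⟨(m k + 1).toNat, by omega⟩, ?_⟩
    have : (((m k + 1).toNat : ℤ) : ℝ) = m k + 1 := by
      rw [Int.toNat_of_nonneg (by omega)]
      push_cast
      ring
    rw [Int.cast_natCast] at this
    simp [this]
  choose e he using hm
  refine ⟨e, ?_, Sum.elim (fun k => σ (α k)) ![σ j, σ j'], ?_⟩
  -- The weights of `μ j` and `μ j'` cancel, leaving the nonzero integer `∑ k, m k`.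
  · simp only [resonanceCoeff, Fintype.sum_sum_type, Sum.elim_inl, Sum.elim_inr, he]
    simp only [Fin.sum_univ_two, Matrix.cons_val_zero, Matrix.cons_val_one]
    rw [add_neg_cancel, add_zero]
    exact_mod_cast Int.one_le_abs hm0
  · refine le_of_eq_of_le (congrArg abs ?_) hres
    simp only [eigenvalueSum, resonanceCoeff, Fintype.sum_sum_type, Sum.elim_inl, Sum.elim_inr, he,
      Fin.sum_univ_two, Matrix.cons_val_zero, Matrix.cons_val_one, hσ]
    ring

/-- Union bound: `3 ^ b` choices of `m`, and `N ^ (b + 2)` choices of eigenvalue indices, `b` for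
`ω` and two for `μ j`, `μ j'`. -/
lemma measure_resonant_le {b : ℕ} {g : ℝ → ℝ} {C₀ γ₀ q₀ L δ s : ℝ} (hδ : 0 < δ)
    {β : Fin b → ℤ} {Ω : Type*} [MeasurableSpace Ω] {P : Measure Ω} [IsProbabilityMeasure P]
    {V : ℤ → Ω → ℝ} (hV : ∀ x, HasLaw (V x) (siteLaw g) P) (hind : iIndepFun V P) :
    P {ω | (fun x => V x ω) ∈ resonantPotentials C₀ γ₀ q₀ L β δ s} ≤
      (3 ^ b * Fintype.card (box δ s) ^ (b + 2) : ℕ) * (Fintype.card (box δ s) *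
        (eLpNorm g ∞ volume * ((Fintype.card (box δ s) ^ (b + 2) : ℕ) *
          ENNReal.ofReal (3 * (4 * δ ^ (1 / 8 : ℝ)))))) := by
  have hA := restrictedHamiltonian_isHermitian 0 (box δ s)
  have hprob : IsProbabilityMeasure (siteLaw g) := by
    rw [← (hV 0).map_eq]
    exact Measure.isProbabilityMeasure_map (hV 0).aemeasurable
  have hmap : P.map (fun ω (x : box δ s) => V x ω) = Measure.pi fun _ => siteLaw g := by
    have hΛ : iIndepFun (fun (x : box δ s) => V x) P := hind.precomp Subtype.val_injective
    rw [iIndepFun.map_fun_eq_pi_map (f := fun (x : box δ s) => V x)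
      (fun x => (hV x).aemeasurable) hΛ]
    simp [(hV _).map_eq]
  have hmeas : AEMeasurable (fun ω (x : box δ s) => V x ω) P :=
    aemeasurable_pi_lambda _ fun x => (hV x).aemeasurable
  -- Putting the weight condition into the event lets the union run over all `m`; it is empty for
  -- the others.
  let U (m : Fin b → Fin 3) (i : Fin b ⊕ Fin 2 → box δ s) : Set (box δ s → ℝ) :=
    {w | 1 ≤ |∑ k, resonanceCoeff m k| ∧
      |eigenvalueSum hA (resonanceCoeff m) i w| ≤ 4 * δ ^ (1 / 8 : ℝ)}
  have hcard : Fintype.card (Fin b ⊕ Fin 2 → box δ s) = Fintype.card (box δ s) ^ (b + 2) := by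
    simp
  have hU : ∀ m i, P ((fun ω (x : box δ s) => V x ω) ⁻¹' U m i) ≤ Fintype.card (box δ s) *
        (eLpNorm g ∞ volume * ((Fintype.card (box δ s) ^ (b + 2) : ℕ) *
          ENNReal.ofReal (3 * (4 * δ ^ (1 / 8 : ℝ))))) := by
    intro m i
    by_cases hm : 1 ≤ |∑ k, resonanceCoeff m k|
    · have hUm : MeasurableSet (U m i) := by
        simp only [U, hm, true_and]
        exact measurableSet_le (continuous_eigenvalueSum hA _ i).abs.measurable measurable_const
      rw [← Measure.map_apply_of_aemeasurable hmeas hUm, hmap, ← hcard]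
      refine (measure_mono fun w hw => hw.2).trans
        (pi_abs_eigenvalueSum_le hA siteLaw_le (resonanceCoeff m) hm i (by positivity))
    · have : U m i = ∅ := by
        exact Set.eq_empty_of_forall_notMem fun w hw => hm hw.1
      simp [this]
  have hsub : {ω | (fun x => V x ω) ∈ resonantPotentials C₀ γ₀ q₀ L β δ s} ⊆
      ⋃ q : (Fin b → Fin 3) × (Fin b ⊕ Fin 2 → box δ s),
        (fun ω (x : box δ s) => V x ω) ⁻¹' U q.1 q.2 := by
    intro ω hω
    obtain ⟨m, hm, i, hi⟩ := exists_abs_eigenvalueSum_le hω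
    exact Set.mem_iUnion.mpr ⟨(m, i), hm, hi⟩
  refine (measure_mono hsub).trans ((measure_iUnion_fintype_le P _).trans
    ((Finset.sum_le_sum fun q _ => hU q.1 q.2).trans (le_of_eq ?_)))
  rw [Finset.sum_const, Finset.card_univ, Fintype.card_prod, hcard, nsmul_eq_mul]
  simp

end RandomSchrodinger

theorem theorem2p6 (b : ℕ) (g : ℝ → ℝ) (hg : RandomSchrodinger.IsSiteDensity g) :
    ∃ C : ℝ, 0 < C ∧ ∀ s : ℝ, 1 < s →
      ∀ L C₀ γ₀ q₀ : ℝ, 0 < L → 0 < C₀ → 0 < γ₀ → 0 < q₀ →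
        ∃ δ₀ : ℝ, 0 < δ₀ ∧ δ₀ < 1 ∧
          ∀ β : Fin b → ℤ, RandomSchrodinger.AdmissibleCenters L β →
          ∀ δ : ℝ, 0 < δ → δ ≤ δ₀ →
          ∀ (Ω : Type*) [MeasurableSpace Ω] (P : Measure Ω) [IsProbabilityMeasure P]
            (V : ℤ → Ω → ℝ),
            (∀ x, HasLaw (V x) (RandomSchrodinger.siteLaw g) P) → iIndepFun V P →
            P {ω | (fun x => V x ω) ∈
                RandomSchrodinger.resonantPotentials C₀ γ₀ q₀ L β δ s} ≤
              ENNReal.ofReal (|Real.log δ| ^ (C * s) * δ ^ (1 / 8 : ℝ)) := by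
  set ρ := (eLpNorm g ∞ volume).toReal with hρ
  set K : ℝ := 3 ^ b * 5 ^ (2 * b + 5) * ρ * 12 + 1 with hK
  have hρ0 : 0 ≤ ρ := ENNReal.toReal_nonneg
  have hK1 : 1 ≤ K := by
    rw [hK]
    linarith [show 0 ≤ 3 ^ b * 5 ^ (2 * b + 5) * ρ * 12 by positivity]
  -- The bound contains `N ^ (2 * b + 5)`: `b + 2` from the indices, `1` from the sites, `b + 2`
  -- from the degree. With `N ≤ 5 * R`, `R = |log δ| ^ s`, one more power of `R` absorbs the
  -- constant, since `δ ≤ exp (-K)` gives `R ≥ K`.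
  refine ⟨((2 * b + 6 : ℕ) : ℝ), by positivity, fun s hs L C₀ γ₀ q₀ _ _ _ _ =>
    ⟨Real.exp (-K), Real.exp_pos _, by simpa using hK1.trans_lt' one_pos,
      fun β _ δ hδ hδK Ω _ P _ V hV hind => ?_⟩⟩
  have hlog : K ≤ |Real.log δ| := by
    have := (Real.log_le_iff_le_exp hδ).mpr hδK
    linarith [neg_le_abs (Real.log δ)]
  have hR : K ≤ |Real.log δ| ^ s :=
    hlog.trans (Real.self_le_rpow_of_one_le (hK1.trans hlog) hs.le)
  have hN := RandomSchrodinger.card_box_le (hK1.trans hR)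
  refine (RandomSchrodinger.measure_resonant_le hδ hV hind).trans ?_
  rw [mul_comm ((2 * b + 6 : ℕ) : ℝ) s, Real.rpow_mul (abs_nonneg _), Real.rpow_natCast]
  set N := Fintype.card (RandomSchrodinger.box δ s)
  set R := |Real.log δ| ^ s
  set d := δ ^ (1 / 8 : ℝ)
  have hd : 0 ≤ d := Real.rpow_nonneg hδ.le _
  rw [← ENNReal.ofReal_toReal hg.bounded.eLpNorm_lt_top.ne, ← hρ, ← ENNReal.ofReal_natCast,
    ← ENNReal.ofReal_natCast, ← ENNReal.ofReal_natCast, ← ENNReal.ofReal_mul (by positivity),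
    ← ENNReal.ofReal_mul hρ0, ← ENNReal.ofReal_mul (by positivity),
    ← ENNReal.ofReal_mul (by positivity)]
  apply ENNReal.ofReal_le_ofReal
  push_cast
  calc (3 : ℝ) ^ b * N ^ (b + 2) * (N * (ρ * (N ^ (b + 2) * (3 * (4 * d)))))
      = 3 ^ b * N ^ (2 * b + 5) * ρ * 12 * d := by ring
    _ ≤ 3 ^ b * (5 * R) ^ (2 * b + 5) * ρ * 12 * d := by gcongr
    _ = (3 ^ b * 5 ^ (2 * b + 5) * ρ * 12) * R ^ (2 * b + 5) * d := by ring
    _ ≤ R * R ^ (2 * b + 5) * d := by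
        gcongr
        linarith
    _ = R ^ (2 * b + 6) * d := by ring
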